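/- Let $n,d\ge 1$ be integers and $S=\mathbb{C}[x_0,\dots,x_n]$. For a point $P\in\mathbb{P}^n$ over $\mathbb{C}$ let $\wp_P\subset S$ be the ideal generated by the homogeneous polynomials vanishing at $P$. For a finite set $X\subset\mathbb{P}^n$ put $I=\bigcap_{P\in X}\wp_P$ and let $I^{(d)}=\bigcap_{P\in X}\wp_P^{\,d}$, the ideal of the scheme of fat points of multiplicity $d$ supported on $X$ (the $d$-th symbolic power of $I$). A subset $G$ of an ideal $J\subset S$ is a Gröbner basis of $J$ for a term order if $G$ generates $J$ and the initial terms of the elements of $G$ generate the initial ideal $\mathrm{in}(J)$. (a) Let $X$ be the set of the $2^n$ $(\pm1)$-points $[1:\pm1:\dots:\pm1]$ of $\mathbb{P}^n$. Then $I^{(d)}=I^d$. Moreover, for every term order on $S$ with $x_n<x_i$ for all $i=0,\dots,n-1$, the set of the monomials of degree $d$ in the $n$ quadrics $x_i^2-x_n^2$, that is, of the products $\prod_{i=0}^{n-1}(x_i^2-x_n^2)^{a_i}$ with $a_i\ge 0$ and $a_0+\dots+a_{n-1}=d$, is a Gröbner basis of $I^{(d)}$. (b) Let $k>2$, let $\xi\in\mathbb{C}$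 be a primitive $k$-th root of unity, and let $X$ be the set of the $k^n$ points $[1:\xi^{g_1}:\dots:\xi^{g_n}]$ of $\mathbb{P}^n$ with $0\le g_j\le k-1$. Then $I^{(d)}=I^d$. Moreover, for every term order on $S$ with $x_n<x_i$ for all $i=0,\dots,n-1$, the set of the products $\prod_{i=0}^{n-1}(x_i^k-x_n^k)^{a_i}$ with $a_i\ge 0$ and $a_0+\dots+a_{n-1}=d$ is a Gröbner basis of $I^{(d)}$. -/

import Mathlib

open MvPolynomial

/-- The prime ideal `℘_P` of a point `P` of `ℙⁿ(ℂ)`: the ideal generated by all homogeneous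
polynomials vanishing at `P`.  For a homogeneous polynomial, vanishing does not depend on the chosen
representative of `P`. -/
noncomputable def pointIdeal {n : ℕ} (P : Projectivization ℂ (Fin (n + 1) → ℂ)) :
    Ideal (MvPolynomial (Fin (n + 1)) ℂ) :=
  Ideal.span {f | (∃ e : ℕ, f.IsHomogeneous e) ∧ eval P.rep f = 0}

/-- The ideal `I = ⋂ ℘_P` of a set `X` of points of `ℙⁿ`. -/
noncomputable def pointsIdeal {n : ℕ} (X : Set (Projectivization ℂ (Fin (n + 1) → ℂ))) :
    Ideal (MvPolynomial (Fin (n + 1)) ℂ) :=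
  ⨅ P ∈ X, pointIdeal P

/-- The ideal `I^{(d)} = ⋂ ℘_P ^ d` of the scheme of fat points of multiplicity `d` supported on
the set `X` of points of `ℙⁿ` (the `d`-th symbolic power of the ideal of `X`). -/
noncomputable def fatPointsIdeal {n : ℕ} (X : Set (Projectivization ℂ (Fin (n + 1) → ℂ))) (d : ℕ) :
    Ideal (MvPolynomial (Fin (n + 1)) ℂ) :=
  ⨅ P ∈ X, pointIdeal P ^ d

/-- The `(±1)`-points `[1 : ±1 : … : ±1]` of `ℙⁿ`. -/
def pmPoints (n : ℕ) : Set (Projectivization ℂ (Fin (n + 1) → ℂ)) :=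
  {P | ∃ (v : Fin (n + 1) → ℂ) (hv : v ≠ 0),
    v 0 = 1 ∧ (∀ j : Fin n, v j.succ = 1 ∨ v j.succ = -1) ∧ P = Projectivization.mk ℂ v hv}

/-- The `ξ`-points `[1 : ξ ^ g₁ : … : ξ ^ gₙ]`, `0 ≤ gⱼ ≤ k - 1`, of `ℙⁿ`. -/
def xiPoints (n k : ℕ) (ξ : ℂ) : Set (Projectivization ℂ (Fin (n + 1) → ℂ)) :=
  {P | ∃ (v : Fin (n + 1) → ℂ) (hv : v ≠ 0) (g : Fin n → Fin k),
    v 0 = 1 ∧ (∀ j : Fin n, v j.succ = ξ ^ (g j : ℕ)) ∧ P = Projectivization.mk ℂ v hv}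

/-- The monomials of degree `d` in the `n` forms `x_i ^ k - x_n ^ k`, `0 ≤ i ≤ n - 1`. -/
def formMonomials (n k d : ℕ) : Set (MvPolynomial (Fin (n + 1)) ℂ) :=
  {f | ∃ a : Fin n → ℕ, ∑ i, a i = d ∧
    f = ∏ i, ((X i.castSucc : MvPolynomial (Fin (n + 1)) ℂ) ^ k - X (Fin.last n) ^ k) ^ a i}

/-- `G` is a Gröbner basis of `I` for the term order `m`: it generates `I`, and the initial terms of
its elements generate the initial ideal of `I`. -/
def IsGroebnerBasis {n : ℕ} (m : MonomialOrder (Fin (n + 1)))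
    (G : Set (MvPolynomial (Fin (n + 1)) ℂ)) (I : Ideal (MvPolynomial (Fin (n + 1)) ℂ)) : Prop :=
  Ideal.span G = I ∧
    Ideal.span (m.leadingTerm '' G) =
      Ideal.span (m.leadingTerm '' (I : Set (MvPolynomial (Fin (n + 1)) ℂ)))

/-! Call `∑ i, a i / k`, summed over `i < n`, the weight of a monomial. The leading exponents of the
products of the forms `x_i ^ k - x_n ^ k` are such that a monomial divisible by none of them has
weight less than `d`. So by division everything reduces to `eq_zero_of_mem_fatPointsIdeal`: an
element of `I^{(d)}` with all monomials of weight less than `d` is zero. Put `x_n = t ≠ 0`. The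
result vanishes to order `d` on the grid of points with coordinates in `t · μ_k`, so by coprimality
and the combinatorial Nullstellensatz it lies in `(x_i ^ k - t ^ k)_i ^ d` (`specialize_mem_pow`).
That power is contained in the span of mixed monomials of weight at least `d`, whose leading
exponents are distinct, so a nonzero element has a monomial of weight at least `d`
(`eq_zero_of_mem_pow_of_support`). Hence every specialization with `t ≠ 0` vanishes, and so does the
polynomial. The equality with `I ^ d` follows, since the products generate `I^{(d)}` and lie in `I ^
d`. -/

/-! ### Mixed monomials and powers of the ideal `(x_i ^ k - c)_i`. -/

section MixedMonomial

variable {σ K : Type*} [Field K]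

/-- The polynomial `x_i ^ (a % k) * (x_i ^ k - c) ^ (a / k)`, monic of degree `a` in `x_i`. -/
noncomputable def mixedPower (k : ℕ) (c : K) (i : σ) (a : ℕ) : MvPolynomial σ K :=
  X i ^ (a % k) * (X i ^ k - C c) ^ (a / k)

lemma mixedPower_zero (k : ℕ) (c : K) (i : σ) : mixedPower k c i 0 = 1 := by
  simp [mixedPower]

lemma sub_mul_mixedPower {k : ℕ} (hk : 0 < k) (c : K) (i : σ) (a : ℕ) :
    (X i ^ k - C c) * mixedPower k c i a = mixedPower k c i (a + k) := by
  simp only [mixedPower, Nat.add_mod_right, Nat.add_div_right a hk, pow_succ]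
  ring

lemma X_mul_mixedPower_of_lt {k : ℕ} (c : K) (i : σ) {a : ℕ} (h : a % k + 1 < k) :
    X i * mixedPower k c i a = mixedPower k c i (a + 1) := by
  have h1 : (a + 1) % k = a % k + 1 := by
    rw [Nat.add_mod, Nat.mod_eq_of_lt (show 1 < k by omega), Nat.mod_eq_of_lt h]
  have h2 : (a + 1) / k = a / k := by
    rw [Nat.add_div (by omega), Nat.mod_eq_of_lt (show 1 < k by omega), if_neg (by omega),
      Nat.div_eq_of_lt (show 1 < k by omega)]
    rfl
  rw [mixedPower, mixedPower, h1, h2, pow_succ]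
  ring

/-- When the remainder wraps around, write `x_i ^ k = (x_i ^ k - c) + c`; neither term has a smaller
quotient by `k`. -/
lemma X_mul_mixedPower_of_eq {k : ℕ} (c : K) (i : σ) {a : ℕ} (hk : 0 < k) (h : a % k + 1 = k) :
    X i * mixedPower k c i a =
      mixedPower k c i (k * (a / k + 1)) + C c * mixedPower k c i (k * (a / k)) := by
  simp only [mixedPower, Nat.mul_mod_right, Nat.mul_div_cancel_left _ hk, pow_zero, one_mul]
  rw [← mul_assoc, ← pow_succ', h, pow_succ]
  ring

namespace MonomialOrder

variable (m : MonomialOrder σ)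

lemma zero_lt_toSyn_single (i : σ) {k : ℕ} (hk : 0 < k) :
    m.toSyn 0 < m.toSyn (Finsupp.single i k) := by
  refine lt_of_le_of_ne (m.toSyn_monotone (show (0 : σ →₀ ℕ) ≤ _ from fun j => Nat.zero_le _)) fun h => ?_
  have := DFunLike.congr_fun (m.toSyn.injective h) i
  simp at this
  omega

lemma degree_X_pow (i : σ) (k : ℕ) :
    m.degree (X i ^ k : MvPolynomial σ K) = Finsupp.single i k := by
  rw [degree_pow, degree_X, Finsupp.smul_single, smul_eq_mul, mul_one]

lemma degree_C_lt_degree_X_pow (i : σ) {k : ℕ} (hk : 0 < k) (c : K) :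
    m.toSyn (m.degree (C c : MvPolynomial σ K)) <
      m.toSyn (m.degree (X i ^ k : MvPolynomial σ K)) := by
  rw [degree_C, degree_X_pow]
  exact m.zero_lt_toSyn_single i hk

lemma monic_X_pow_sub_C (i : σ) {k : ℕ} (hk : 0 < k) (c : K) :
    m.Monic (X i ^ k - C c : MvPolynomial σ K) := by
  rw [Monic, leadingCoeff_sub_of_lt (m.degree_C_lt_degree_X_pow i hk c)]
  exact monic_X.pow

lemma degree_X_pow_sub_C (i : σ) {k : ℕ} (hk : 0 < k) (c : K) :
    m.degree (X i ^ k - C c : MvPolynomial σ K) = Finsupp.single i k := by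
  rw [degree_sub_of_lt (m.degree_C_lt_degree_X_pow i hk c), degree_X_pow]

lemma monic_mixedPower {k : ℕ} (hk : 0 < k) (c : K) (i : σ) (a : ℕ) :
    m.Monic (mixedPower k c i a) :=
  monic_X.pow.mul (m.monic_X_pow_sub_C i hk c).pow

lemma degree_mixedPower {k : ℕ} (hk : 0 < k) (c : K) (i : σ) (a : ℕ) :
    m.degree (mixedPower k c i a) = Finsupp.single i a := by
  rw [mixedPower, degree_mul (monic_X.pow (m := m)).ne_zero
    (m.monic_X_pow_sub_C i hk c).pow.ne_zero, degree_X_pow, degree_pow,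
    degree_X_pow_sub_C m i hk, Finsupp.smul_single, ← Finsupp.single_add, smul_eq_mul, mul_comm,
    Nat.mod_add_div]

end MonomialOrder

variable [Fintype σ]

/-- The product of the polynomials `x_i ^ (α_i % k) * (x_i ^ k - c) ^ (α_i / k)`. -/
noncomputable def mixedMonomial (k : ℕ) (c : K) (α : σ →₀ ℕ) : MvPolynomial σ K :=
  ∏ i, mixedPower k c i (α i)

lemma MonomialOrder.monic_mixedMonomial (m : MonomialOrder σ) {k : ℕ} (hk : 0 < k) (c : K)
    (α : σ →₀ ℕ) : m.Monic (mixedMonomial k c α) :=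
  Monic.prod fun i _ => m.monic_mixedPower hk c i _

/-- Distinct exponents thus give distinct leading exponents, for every monomial order, so top terms
cannot cancel in a linear combination. -/
lemma MonomialOrder.degree_mixedMonomial (m : MonomialOrder σ) {k : ℕ} (hk : 0 < k) (c : K)
    (α : σ →₀ ℕ) : m.degree (mixedMonomial k c α) = α := by
  rw [mixedMonomial, degree_prod fun i _ => (m.monic_mixedPower hk c i _).ne_zero]
  simp only [m.degree_mixedPower hk, Finsupp.univ_sum_single]

lemma mixedMonomial_zero (k : ℕ) (c : K) : mixedMonomial k c (0 : σ →₀ ℕ) = 1 := by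
  simp [mixedMonomial, mixedPower_zero]

lemma mixedMonomial_update [DecidableEq σ] (k : ℕ) (c : K) (α : σ →₀ ℕ) (i : σ) (a : ℕ) :
    mixedMonomial k c (α.update i a) =
      mixedPower k c i a * ∏ j ∈ Finset.univ.erase i, mixedPower k c j (α j) := by
  rw [mixedMonomial, ← Finset.mul_prod_erase _ _ (Finset.mem_univ i)]
  congr 1
  · simp
  · refine Finset.prod_congr rfl fun j hj => ?_
    simp [Finset.ne_of_mem_erase hj]

lemma mixedMonomial_eq [DecidableEq σ] (k : ℕ) (c : K) (α : σ →₀ ℕ) (i : σ) :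
    mixedMonomial k c α =
      mixedPower k c i (α i) * ∏ j ∈ Finset.univ.erase i, mixedPower k c j (α j) := by
  rw [← mixedMonomial_update, Finsupp.update_self]

/-- The linear span of the mixed monomials of weight at least `e`. -/
noncomputable def mixedSpan (σ : Type*) [Fintype σ] (k : ℕ) (c : K) (e : ℕ) :
    Submodule K (MvPolynomial σ K) :=
  Submodule.span K (mixedMonomial k c '' {α | e ≤ ∑ i, α i / k})

lemma mixedMonomial_mem_mixedSpan (k : ℕ) (c : K) {e : ℕ} {α : σ →₀ ℕ} (h : e ≤ ∑ i, α i / k) :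
    mixedMonomial k c α ∈ mixedSpan σ k c e :=
  Submodule.subset_span ⟨α, h, rfl⟩

lemma le_sum_update_div [DecidableEq σ] (k : ℕ) {α : σ →₀ ℕ} {i : σ} {a : ℕ}
    (h : α i / k ≤ a / k) : ∑ j, α j / k ≤ ∑ j, (α.update i a) j / k := by
  refine Finset.sum_le_sum fun j _ => ?_
  by_cases hj : j = i
  · subst hj; simpa using h
  · simp [hj]

lemma X_mul_mem_mixedSpan {k : ℕ} (hk : 0 < k) (c : K) {e : ℕ} (i : σ) {p : MvPolynomial σ K}
    (hp : p ∈ mixedSpan σ k c e) : X i * p ∈ mixedSpan σ k c e := by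
  classical
  induction hp using Submodule.span_induction with
  | zero => simp
  | add p q _ _ hp hq => rw [mul_add]; exact add_mem hp hq
  | smul a p _ hp => rw [mul_smul_comm]; exact Submodule.smul_mem _ _ hp
  | mem p hp =>
    obtain ⟨α, hα, rfl⟩ := hp
    rw [mixedMonomial_eq k c α i, ← mul_assoc]
    rcases lt_or_eq_of_le (Nat.succ_le_of_lt (Nat.mod_lt (α i) hk)) with h | h
    · rw [X_mul_mixedPower_of_lt c i h, ← mixedMonomial_update]
      exact mixedMonomial_mem_mixedSpan k c
        (le_trans hα (le_sum_update_div k (Nat.div_le_div_right (Nat.le_succ _))))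
    · rw [X_mul_mixedPower_of_eq c i hk h, add_mul, mul_assoc (C c), ← mixedMonomial_update,
        ← mixedMonomial_update, ← smul_eq_C_mul]
      refine add_mem ?_ (Submodule.smul_mem _ _ ?_) <;>
      refine mixedMonomial_mem_mixedSpan k c (le_trans hα (le_sum_update_div k ?_)) <;>
      simp [Nat.mul_div_cancel_left _ hk]

lemma mul_mem_mixedSpan {k : ℕ} (hk : 0 < k) (c : K) {e : ℕ} (q : MvPolynomial σ K)
    {p : MvPolynomial σ K} (hp : p ∈ mixedSpan σ k c e) : q * p ∈ mixedSpan σ k c e := by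
  induction q using MvPolynomial.induction_on with
  | C a => rw [← smul_eq_C_mul]; exact Submodule.smul_mem _ _ hp
  | add q r hq hr => rw [add_mul]; exact add_mem hq hr
  | mul_X q i hq =>
    rw [mul_comm q, mul_assoc]
    exact X_mul_mem_mixedSpan hk c i hq

lemma sub_mul_mem_mixedSpan {k : ℕ} (hk : 0 < k) (c : K) {e : ℕ} (i : σ) {p : MvPolynomial σ K}
    (hp : p ∈ mixedSpan σ k c e) : (X i ^ k - C c) * p ∈ mixedSpan σ k c (e + 1) := by
  classical
  induction hp using Submodule.span_induction with
  | zero => simp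
  | add p q _ _ hp hq => rw [mul_add]; exact add_mem hp hq
  | smul a p _ hp => rw [mul_smul_comm]; exact Submodule.smul_mem _ _ hp
  | mem p hp =>
    obtain ⟨α, hα, rfl⟩ := hp
    rw [mixedMonomial_eq k c α i, ← mul_assoc, sub_mul_mixedPower hk, ← mixedMonomial_update]
    refine mixedMonomial_mem_mixedSpan k c (Nat.succ_le_of_lt (lt_of_le_of_lt hα ?_))
    refine Finset.sum_lt_sum (fun j _ => ?_) ⟨i, Finset.mem_univ i, ?_⟩
    · by_cases hj : j = i
      · subst hj; simp [Nat.add_div_right _ hk]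
      · simp [hj]
    · simp [Nat.add_div_right _ hk]

/-- The span is stable under multiplication by any polynomial, and each factor `x_i ^ k - c` raises
the weight by one. -/
lemma mem_mixedSpan_of_mem_pow {k : ℕ} (hk : 0 < k) (c : K) (e : ℕ) {p : MvPolynomial σ K}
    (hp : p ∈ Ideal.span (Set.range fun i : σ => (X i ^ k - C c : MvPolynomial σ K)) ^ e) :
    p ∈ mixedSpan σ k c e := by
  induction e generalizing p with
  | zero =>
    rw [← mul_one p, ← mixedMonomial_zero k c]
    exact mul_mem_mixedSpan hk c p (mixedMonomial_mem_mixedSpan k c (Nat.zero_le _))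
  | succ e ih =>
    rw [pow_succ'] at hp
    refine Submodule.mul_induction_on hp (fun q hq r hr => ?_) fun q r hq hr => add_mem hq hr
    have hr := ih hr
    induction hq using Submodule.span_induction with
    | zero => simp
    | add p q _ _ hp hq => rw [add_mul]; exact add_mem hp hq
    | smul a p _ hp =>
      rw [smul_eq_mul, mul_assoc]
      exact mul_mem_mixedSpan hk c a hp
    | mem p hp =>
      obtain ⟨i, rfl⟩ := hp
      exact sub_mul_mem_mixedSpan hk c i hr

/-- An element of the `e`-th power of `(x_i ^ k - c)_i` all of whose monomials have weight less
than `e` vanishes. -/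
lemma eq_zero_of_mem_pow_of_support (m : MonomialOrder σ) {k : ℕ} (hk : 0 < k) (c : K) (e : ℕ)
    {p : MvPolynomial σ K}
    (hp : p ∈ Ideal.span (Set.range fun i : σ => (X i ^ k - C c : MvPolynomial σ K)) ^ e)
    (hs : ∀ a ∈ p.support, ∑ i, a i / k < e) : p = 0 := by
  obtain ⟨l, hl, rfl⟩ := (Finsupp.mem_span_image_iff_linearCombination K).1
    (mem_mixedSpan_of_mem_pow hk c e hp)
  by_contra hne
  have hl0 : l.support.Nonempty := by
    rw [Finsupp.support_nonempty_iff]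
    rintro rfl
    simp at hne
  -- The largest `α` in the combination survives as a monomial of `p`, yet its weight is at least
  -- `e`.
  obtain ⟨α, hα, hmax⟩ := Finset.exists_max_image l.support m.toSyn hl0
  have hcoeff : coeff α (Finsupp.linearCombination K (mixedMonomial k c) l) = l α := by
    rw [Finsupp.linearCombination_apply, Finsupp.sum, coeff_sum, Finset.sum_eq_single α]
    · have := (m.monic_mixedMonomial hk c α).coeff_degree
      rw [m.degree_mixedMonomial hk] at this
      simp [this]
    · intro β hβ hne
      rw [coeff_smul, m.coeff_eq_zero_of_lt, smul_zero]
      rw [m.degree_mixedMonomial hk]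
      exact lt_of_le_of_ne (hmax β hβ) fun h => hne (m.toSyn.injective h)
    · exact fun h => absurd hα h
  refine absurd (hs α ?_) (not_lt.2 (hl hα))
  rw [mem_support_iff, hcoeff]
  exact Finsupp.mem_support_iff.1 hα

end MixedMonomial

/-! ### Vanishing to order `d` on a finite grid. -/

section Grid

variable {σ K : Type*} [Field K]

/-- The ideal of polynomials vanishing at the point `u` of affine space. -/
noncomputable def evalIdeal (u : σ → K) : Ideal (MvPolynomial σ K) := RingHom.ker (eval u)

lemma mem_evalIdeal {u : σ → K} {p : MvPolynomial σ K} : p ∈ evalIdeal u ↔ eval u p = 0 :=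
  RingHom.mem_ker

lemma isCoprime_evalIdeal {u v : σ → K} (h : u ≠ v) : IsCoprime (evalIdeal u) (evalIdeal v) := by
  obtain ⟨i, hi⟩ := Function.ne_iff.1 h
  have hi : u i - v i ≠ 0 := sub_ne_zero.2 hi
  rw [Ideal.isCoprime_iff_exists]
  refine ⟨C (-(u i - v i)⁻¹) * (X i - C (u i)), ?_, C (u i - v i)⁻¹ * (X i - C (v i)), ?_, ?_⟩
  · simp [mem_evalIdeal]
  · simp [mem_evalIdeal]
  · have : (C (u i - v i)⁻¹ * C (u i - v i) : MvPolynomial σ K) = 1 := by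
      rw [← C_mul, inv_mul_cancel₀ hi, C_1]
    rw [C_neg, ← this, C_sub]
    ring

/-- A polynomial vanishing to order `d` at the points of a finite grid lies in the `d`-th power of
the ideal generated by the polynomials defining the grid. -/
lemma mem_pow_of_mem_evalIdeal_pow [Finite σ] (S : σ → Finset K) (hS : ∀ i, (S i).Nonempty) (d : ℕ)
    {p : MvPolynomial σ K}
    (hp : ∀ u : σ → K, (∀ i, u i ∈ S i) → p ∈ evalIdeal u ^ d) :
    p ∈ Ideal.span (Set.range fun i : σ => ∏ s ∈ S i, (X i - C s : MvPolynomial σ K)) ^ d := by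
  classical
  have := Fintype.ofFinite σ
  have hcop : (Fintype.piFinset S : Set (σ → K)).Pairwise
      (Function.onFun IsCoprime (evalIdeal (K := K))) := fun u _ v _ h => isCoprime_evalIdeal h
  -- Pairwise coprimality turns the intersection of `d`-th powers into the `d`-th power of the
  -- product, reducing the claim to `d = 1`.
  have h1 : p ∈ (∏ u ∈ Fintype.piFinset S, evalIdeal u) ^ d := by
    rw [← Finset.prod_pow, Ideal.prod_eq_iInf_of_pairwise_isCoprime
      (hcop.imp fun _ _ h => h.pow)]
    simpa [Submodule.mem_iInf] using hp
  refine Ideal.pow_right_mono ?_ d h1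
  rw [Ideal.prod_eq_iInf_of_pairwise_isCoprime hcop]
  intro q hq
  simp only [Submodule.mem_iInf, Fintype.mem_piFinset, mem_evalIdeal] at hq
  obtain ⟨h, -, rfl⟩ := combinatorial_nullstellensatz_exists_linearCombination S hS q hq
  rw [Finsupp.linearCombination_apply]
  exact Submodule.sum_mem _ fun i _ =>
    Ideal.mul_mem_left _ _ (Ideal.subset_span ⟨i, rfl⟩)

end Grid

/-! ### A Gröbner basis criterion by division. -/

section GroebnerBasis

variable {σ K : Type*} [Field K]

/-- A set `G` of nonzero elements of `I` such that no nonzero element of `I` is reduced with respect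
to `G` generates `I`, and its leading terms generate the initial ideal. -/
lemma span_eq_and_span_leadingTerm_eq (m : MonomialOrder σ) {G : Set (MvPolynomial σ K)}
    {I : Ideal (MvPolynomial σ K)} (hG : ∀ b ∈ G, b ≠ 0) (hGI : G ⊆ I)
    (hI : ∀ r ∈ I, (∀ c ∈ r.support, ∀ b ∈ G, ¬ m.degree b ≤ c) → r = 0) :
    Ideal.span G = I ∧ Ideal.span (m.leadingTerm '' G) =
      Ideal.span (m.leadingTerm '' (I : Set (MvPolynomial σ K))) := by
  have hdiv : ∀ f ∈ I, ∃ g : G →₀ MvPolynomial σ K,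
      f = Finsupp.linearCombination _ (fun b : G => (b : MvPolynomial σ K)) g ∧
      ∀ b : G, m.toSyn (m.degree ((b : MvPolynomial σ K) * g b)) ≤ m.toSyn (m.degree f) := by
    intro f hf
    obtain ⟨g, r, hfr, hg, hr⟩ := m.div_set (B := G)
      (fun b hb => (m.leadingCoeff_ne_zero_iff.2 (hG b hb)).isUnit) f
    refine ⟨g, ?_, hg⟩
    have hmem : Finsupp.linearCombination _ (fun b : G => (b : MvPolynomial σ K)) g ∈ I := by
      rw [Finsupp.linearCombination_apply]
      exact Submodule.sum_mem _ fun b _ => Ideal.mul_mem_left _ _ (hGI b.2)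
    have : r = 0 := hI r (by
      rw [← sub_eq_of_eq_add' hfr]
      exact sub_mem hf hmem) hr
    rw [hfr, this, add_zero]
  refine ⟨le_antisymm (Ideal.span_le.2 hGI) fun f hf => ?_,
    le_antisymm (Ideal.span_mono (Set.image_mono hGI)) (Ideal.span_le.2 ?_)⟩
  · obtain ⟨g, hfg, -⟩ := hdiv f hf
    rw [hfg, Finsupp.linearCombination_apply]
    exact Submodule.sum_mem _ fun b _ => Ideal.mul_mem_left _ _ (Ideal.subset_span b.2)
  · rintro _ ⟨f, hf, rfl⟩
    by_cases hf0 : f = 0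
    · simp [hf0]
    obtain ⟨g, hfg, hg⟩ := hdiv f hf
    have hc : coeff (m.degree f) f ≠ 0 := m.coeff_degree_ne_zero_iff.2 hf0
    -- Some summand contributes to the leading monomial of `f`; the degree bound from the division
    -- makes that its own leading monomial.
    obtain ⟨b, hb⟩ : ∃ b : G, coeff (m.degree f) ((b : MvPolynomial σ K) * g b) ≠ 0 := by
      by_contra! h
      apply hc
      rw [congrArg (coeff (m.degree f)) hfg, Finsupp.linearCombination_apply, Finsupp.sum,
        coeff_sum]
      exact Finset.sum_eq_zero fun b _ => by rw [smul_eq_mul, mul_comm]; exact h b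
    have hdeg : m.degree f = m.degree (b : MvPolynomial σ K) + m.degree (g b) := by
      have hne : (b : MvPolynomial σ K) * g b ≠ 0 := by
        intro h; rw [h] at hb; simp at hb
      rw [← m.degree_mul' hne]
      exact m.toSyn.injective (le_antisymm (m.le_degree (mem_support_iff.2 hb)) (hg b))
    have hlc := m.leadingCoeff_ne_zero_iff.2 (hG b b.2)
    have : m.leadingTerm f =
        monomial (m.degree (g b)) (m.leadingCoeff f * (m.leadingCoeff (b : MvPolynomial σ K))⁻¹) *
          m.leadingTerm (b : MvPolynomial σ K) := by
      rw [MonomialOrder.leadingTerm, MonomialOrder.leadingTerm, monomial_mul, hdeg,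
        add_comm, inv_mul_cancel_right₀ hlc]
    rw [this]
    exact Ideal.mul_mem_left _ _ (Ideal.subset_span ⟨b, b.2, rfl⟩)

end GroebnerBasis

/-! ### Dehomogenization at `x_n = t`. -/

section Specialization

variable {n : ℕ}

/-- Substitution of the constant `t` for the last variable. -/
noncomputable def specialize (n : ℕ) (t : ℂ) :
    MvPolynomial (Fin (n + 1)) ℂ →ₐ[ℂ] MvPolynomial (Fin n) ℂ :=
  aeval (Fin.snoc (α := fun _ => MvPolynomial (Fin n) ℂ) X (C t))

lemma specialize_monomial (t : ℂ) (a : Fin (n + 1) →₀ ℕ) (c : ℂ) :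
    specialize n t (monomial a c) =
      monomial (a.comapDomain Fin.castSucc (Fin.castSucc_injective n).injOn)
        (c * t ^ a (Fin.last n)) := by
  rw [specialize, aeval_monomial, Finsupp.prod_fintype _ _ (fun _ => pow_zero _),
    Fin.prod_univ_castSucc, monomial_eq, Finsupp.prod_fintype _ _ (fun _ => pow_zero _)]
  simp only [Fin.snoc_castSucc, Fin.snoc_last, algebraMap_eq, Finsupp.comapDomain_apply, C_mul,
    C_pow]
  ring

lemma eval_specialize (t : ℂ) (u : Fin n → ℂ) (f : MvPolynomial (Fin (n + 1)) ℂ) :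
    eval u (specialize n t f) = eval (Fin.snoc (α := fun _ => ℂ) u t) f := by
  have : (eval u).comp (specialize n t : _ →+* _) = eval (Fin.snoc (α := fun _ => ℂ) u t) := by
    refine MvPolynomial.ringHom_ext (fun c => by simp [specialize]) fun i => ?_
    refine Fin.lastCases ?_ (fun j => ?_) i <;> simp [specialize]
  exact RingHom.congr_fun this f

lemma exists_mem_support_of_mem_support_specialize {t : ℂ} {f : MvPolynomial (Fin (n + 1)) ℂ}
    {b : Fin n →₀ ℕ} (hb : b ∈ (specialize n t f).support) :
    ∃ a ∈ f.support, ∀ i : Fin n, b i = a i.castSucc := by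
  by_contra! h
  refine mem_support_iff.1 hb ?_
  rw [f.as_sum, map_sum, coeff_sum]
  refine Finset.sum_eq_zero fun a ha => ?_
  obtain ⟨i, hi⟩ := h a ha
  rw [specialize_monomial, coeff_monomial, if_neg]
  rintro rfl
  exact hi rfl

lemma eq_zero_of_specialize_eq_zero {f : MvPolynomial (Fin (n + 1)) ℂ}
    (h : ∀ t : ℂ, t ≠ 0 → specialize n t f = 0) : f = 0 := by
  -- The factor `x_n` takes care of the excluded value `t = 0`.
  have : f * X (Fin.last n) = 0 := by
    refine MvPolynomial.funext fun w => ?_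
    by_cases hw : w (Fin.last n) = 0
    · simp [hw]
    · have := eval_specialize (w (Fin.last n)) (fun i => w i.castSucc) f
      rw [h _ hw, map_zero] at this
      have hs : Fin.snoc (α := fun _ => ℂ) (fun i => w i.castSucc) (w (Fin.last n)) = w :=
        Fin.snoc_init_self w
      rw [hs] at this
      simp [← this]
  exact (mul_eq_zero.1 this).resolve_right (X_ne_zero _)

lemma MvPolynomial.IsHomogeneous.eval_smul_eq {σ R : Type*} [Fintype σ] [CommRing R]
    {f : MvPolynomial σ R} {e : ℕ} (hf : f.IsHomogeneous e) (c : R) (v : σ → R) :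
    eval (c • v) f = c ^ e * eval v f := by
  rw [eval_eq', eval_eq', Finset.mul_sum]
  refine Finset.sum_congr rfl fun a ha => ?_
  have : ∑ i, a i = e := by
    rw [← Finsupp.degree_eq_sum, Finsupp.degree_eq_weight_one]
    exact hf (mem_support_iff.1 ha)
  simp only [Pi.smul_apply, smul_eq_mul, mul_pow, Finset.prod_mul_distrib,
    Finset.prod_pow_eq_pow_sum, this]
  ring

end Specialization

/-! ### The points with root-of-unity coordinates and their fat ideals. -/

section RootPoints

variable {n k : ℕ} {ξ : ℂ}

/-- This homogeneous description allows normalizing by the last coordinate instead of the first. -/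
lemma mem_xiPoints_iff (hk : 0 < k) (hξ : IsPrimitiveRoot ξ k)
    (P : Projectivization ℂ (Fin (n + 1) → ℂ)) :
    P ∈ xiPoints n k ξ ↔ ∀ i, P.rep i ^ k = P.rep (Fin.last n) ^ k := by
  constructor
  · rintro ⟨v, hv, g, h0, hg, rfl⟩
    obtain ⟨c, hc⟩ := Projectivization.exists_smul_eq_mk_rep ℂ v hv
    have h1 : ∀ i, v i ^ k = 1 := by
      intro i
      refine Fin.cases (by simp [h0]) (fun j => ?_) i
      rw [hg, ← pow_mul, mul_comm, pow_mul, hξ.pow_eq_one, one_pow]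
    intro i
    rw [← hc]
    simp only [Pi.smul_apply, Units.smul_def, smul_eq_mul, mul_pow, h1]
  · intro h
    have hlast : P.rep (Fin.last n) ≠ 0 := by
      intro h0
      refine P.rep_nonzero (funext fun i => ?_)
      have := h i
      rw [h0, zero_pow hk.ne'] at this
      exact eq_zero_of_pow_eq_zero this
    have h0 : P.rep 0 ≠ 0 := by
      intro h0
      have := h 0
      rw [h0, zero_pow hk.ne'] at this
      exact hlast (eq_zero_of_pow_eq_zero this.symm)
    have hroot : ∀ j : Fin n, ∃ g : Fin k, ((P.rep 0)⁻¹ • P.rep) j.succ = ξ ^ (g : ℕ) := by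
      intro j
      have : NeZero k := ⟨hk.ne'⟩
      obtain ⟨g, hg, hg'⟩ := hξ.eq_pow_of_pow_eq_one
        (ξ := ((P.rep 0)⁻¹ • P.rep) j.succ) (by
          rw [Pi.smul_apply, smul_eq_mul, mul_pow, h, ← h 0, ← mul_pow, inv_mul_cancel₀ h0,
            one_pow])
      exact ⟨⟨g, hg⟩, hg'.symm⟩
    choose g hg using hroot
    refine ⟨(P.rep 0)⁻¹ • P.rep, smul_ne_zero (inv_ne_zero h0) P.rep_nonzero, g, ?_, hg, ?_⟩
    · simp [h0]
    · conv_lhs => rw [← P.mk_rep]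
      rw [Projectivization.mk_eq_mk_iff']
      exact ⟨P.rep 0, by rw [smul_smul, mul_inv_cancel₀ h0, one_smul]⟩

lemma pmPoints_eq_xiPoints (n : ℕ) : pmPoints n = xiPoints n 2 (-1) := by
  ext P
  constructor
  · rintro ⟨v, hv, h0, hj, rfl⟩
    have : ∀ j : Fin n, ∃ g : Fin 2, v j.succ = (-1) ^ (g : ℕ) := fun j =>
      (hj j).elim (fun h => ⟨0, by simp [h]⟩) fun h => ⟨1, by simp [h]⟩
    choose g hg using this
    exact ⟨v, hv, g, h0, hg, rfl⟩
  · rintro ⟨v, hv, g, h0, hg, rfl⟩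
    exact ⟨v, hv, h0, fun j => by rw [hg]; exact neg_one_pow_eq_or ℂ _, rfl⟩

lemma sub_mem_pointsIdeal (hk : 0 < k) (hξ : IsPrimitiveRoot ξ k) (i : Fin n) :
    (X i.castSucc ^ k - X (Fin.last n) ^ k : MvPolynomial (Fin (n + 1)) ℂ) ∈
      pointsIdeal (xiPoints n k ξ) := by
  rw [pointsIdeal]
  simp only [Submodule.mem_iInf]
  intro P hP
  refine Ideal.subset_span ⟨⟨k, (isHomogeneous_X_pow _ _).sub (isHomogeneous_X_pow _ _)⟩, ?_⟩
  simp [(mem_xiPoints_iff hk hξ P).1 hP i.castSucc]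

lemma pointsIdeal_pow_le_fatPointsIdeal (Y : Set (Projectivization ℂ (Fin (n + 1) → ℂ))) (d : ℕ) :
    pointsIdeal Y ^ d ≤ fatPointsIdeal Y d :=
  le_iInf₂ fun P hP => Ideal.pow_right_mono (iInf₂_le P hP) d

lemma formMonomials_subset (hk : 0 < k) (hξ : IsPrimitiveRoot ξ k) (d : ℕ) :
    formMonomials n k d ⊆ (pointsIdeal (xiPoints n k ξ) ^ d : Ideal _) := by
  rintro _ ⟨a, rfl, rfl⟩
  rw [← Finset.prod_pow_eq_pow_sum]
  exact Ideal.prod_mem_prod fun i _ => Ideal.pow_mem_pow (sub_mem_pointsIdeal hk hξ i) _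

lemma specialize_mem_evalIdeal {P : Projectivization ℂ (Fin (n + 1) → ℂ)} {t : ℂ} {u : Fin n → ℂ}
    {c : ℂ} (h : c • P.rep = Fin.snoc (α := fun _ => ℂ) u t) :
    pointIdeal P ≤ (evalIdeal u).comap (specialize n t) := by
  refine Ideal.span_le.2 ?_
  rintro f ⟨⟨e, he⟩, hf⟩
  rw [SetLike.mem_coe, Ideal.mem_comap, mem_evalIdeal, eval_specialize, ← h, he.eval_smul_eq, hf,
    mul_zero]

lemma specialize_mem_pow (hk : 0 < k) (hξ : IsPrimitiveRoot ξ k) {d : ℕ}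
    {f : MvPolynomial (Fin (n + 1)) ℂ} (hf : f ∈ fatPointsIdeal (xiPoints n k ξ) d) {t : ℂ}
    (ht : t ≠ 0) : specialize n t f ∈
      Ideal.span (Set.range fun i : Fin n => (X i ^ k - C (t ^ k) : MvPolynomial (Fin n) ℂ)) ^ d := by
  classical
  let S : Finset ℂ := (Polynomial.nthRootsFinset k (1 : ℂ)).image (· * t)
  have hprod : ∀ i : Fin n,
      (X i ^ k - C (t ^ k) : MvPolynomial (Fin n) ℂ) = ∏ s ∈ S, (X i - C s) := by
    intro i
    rw [Finset.prod_image fun a _ b _ h => mul_right_cancel₀ ht h, C_pow]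
    have hinj := C_injective (Fin n) ℂ
    rw [(hξ.map_of_injective hinj).pow_sub_pow_eq_prod_sub_mul _ _ hk]
    refine (Finset.prod_nbij (C : ℂ → MvPolynomial (Fin n) ℂ) ?_ hinj.injOn ?_ ?_).symm
    · intro a ha
      rw [Polynomial.mem_nthRootsFinset hk] at ha ⊢
      rw [← C_pow, ha, C_1]
    · intro b hb
      have : NeZero k := ⟨hk.ne'⟩
      rw [Finset.mem_coe, Polynomial.mem_nthRootsFinset hk] at hb
      obtain ⟨j, -, rfl⟩ := (hξ.map_of_injective hinj).eq_pow_of_pow_eq_one hb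
      refine ⟨ξ ^ j, ?_, by simp⟩
      rw [Finset.mem_coe, Polynomial.mem_nthRootsFinset hk, ← pow_mul, mul_comm, pow_mul,
        hξ.pow_eq_one, one_pow]
    · intro a _
      rw [C_mul]
  simp only [hprod]
  refine mem_pow_of_mem_evalIdeal_pow (fun _ => S) (fun _ => ?_) d fun u hu => ?_
  · exact Finset.Nonempty.image ⟨1, by simp [Polynomial.mem_nthRootsFinset hk]⟩ _
  -- Each affine grid point lifts to a point of `X` by appending the coordinate `t`.
  let w : Fin (n + 1) → ℂ := Fin.snoc (α := fun _ => ℂ) u t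
  have hwk : ∀ i, w i ^ k = t ^ k := by
    intro i
    refine Fin.lastCases (by simp [w]) (fun j => ?_) i
    obtain ⟨z, hz, hzu⟩ := Finset.mem_image.1 (hu j)
    rw [Polynomial.mem_nthRootsFinset hk] at hz
    simp only [w, Fin.snoc_castSucc, ← hzu, mul_pow, hz, one_mul]
  have hw : w ≠ 0 := fun h => ht (by simpa [w] using congr_fun h (Fin.last n))
  obtain ⟨c, hc⟩ := Projectivization.exists_smul_eq_mk_rep ℂ w hw
  have hP : Projectivization.mk ℂ w hw ∈ xiPoints n k ξ := by
    rw [mem_xiPoints_iff hk hξ, ← hc]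
    intro i
    simp only [Pi.smul_apply, Units.smul_def, smul_eq_mul, mul_pow, hwk]
  have hfP : f ∈ pointIdeal (Projectivization.mk ℂ w hw) ^ d := by
    rw [fatPointsIdeal] at hf
    simp only [Submodule.mem_iInf] at hf
    exact hf _ hP
  have hle : pointIdeal (Projectivization.mk ℂ w hw) ≤ (evalIdeal u).comap (specialize n t) :=
    specialize_mem_evalIdeal (c := (c⁻¹ : ℂˣ)) (by
      rw [← hc, ← Units.smul_def, inv_smul_smul])
  exact Ideal.le_comap_pow _ _ (Ideal.pow_right_mono hle d hfP)

lemma eq_zero_of_mem_fatPointsIdeal (hk : 0 < k) (hξ : IsPrimitiveRoot ξ k) {d : ℕ}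
    {f : MvPolynomial (Fin (n + 1)) ℂ} (hf : f ∈ fatPointsIdeal (xiPoints n k ξ) d)
    (hs : ∀ a ∈ f.support, ∑ i : Fin n, a i.castSucc / k < d) : f = 0 := by
  refine eq_zero_of_specialize_eq_zero fun t ht =>
    eq_zero_of_mem_pow_of_support MonomialOrder.lex hk (t ^ k) d (specialize_mem_pow hk hξ hf ht)
      fun b hb => ?_
  obtain ⟨a, ha, hab⟩ := exists_mem_support_of_mem_support_specialize hb
  simpa only [hab] using hs a ha

lemma degree_X_pow_lt (m : MonomialOrder (Fin (n + 1))) (hk : 0 < k) {i : Fin n}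
    (hm : m.toSyn (Finsupp.single (Fin.last n) 1) < m.toSyn (Finsupp.single i.castSucc 1)) :
    m.toSyn (m.degree (X (Fin.last n) ^ k : MvPolynomial (Fin (n + 1)) ℂ)) <
      m.toSyn (m.degree (X i.castSucc ^ k : MvPolynomial (Fin (n + 1)) ℂ)) := by
  rw [MonomialOrder.degree_pow, MonomialOrder.degree_pow, MonomialOrder.degree_X,
    MonomialOrder.degree_X, map_nsmul, map_nsmul]
  exact nsmul_lt_nsmul_right hk.ne' hm

lemma isGroebnerBasis_formMonomials (hk : 0 < k) (hξ : IsPrimitiveRoot ξ k) (d : ℕ)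
    (m : MonomialOrder (Fin (n + 1)))
    (hm : ∀ i : Fin n,
      m.toSyn (Finsupp.single (Fin.last n) 1) < m.toSyn (Finsupp.single i.castSucc 1)) :
    IsGroebnerBasis m (formMonomials n k d) (fatPointsIdeal (xiPoints n k ξ) d) := by
  have hdeg : ∀ i : Fin n, m.degree
      (X i.castSucc ^ k - X (Fin.last n) ^ k : MvPolynomial (Fin (n + 1)) ℂ) =
        Finsupp.single i.castSucc k := fun i => by
    rw [m.degree_sub_of_lt (degree_X_pow_lt m hk (hm i)), m.degree_X_pow]
  have hne : ∀ i : Fin n,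
      (X i.castSucc ^ k - X (Fin.last n) ^ k : MvPolynomial (Fin (n + 1)) ℂ) ≠ 0 := fun i => by
    refine m.ne_zero_of_degree_ne_zero ?_
    rw [hdeg, Finsupp.single_ne_zero]
    exact hk.ne'
  refine span_eq_and_span_leadingTerm_eq m ?_ ((formMonomials_subset hk hξ d).trans
    (pointsIdeal_pow_le_fatPointsIdeal _ d)) fun r hr hred =>
    eq_zero_of_mem_fatPointsIdeal hk hξ hr fun c hc => ?_
  · rintro _ ⟨a, -, rfl⟩
    exact Finset.prod_ne_zero_iff.2 fun i _ => pow_ne_zero _ (hne i)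
  · by_contra! h
    -- A weight of at least `d` leaves room for `a` with sum exactly `d` below the quotients `c_i /
    -- k`; the corresponding product has leading exponent `k * a_i` in `x_i`, hence dividing `c`.
    obtain ⟨a, ha, had⟩ := Finsupp.exists_le_degree_eq
      (Finsupp.equivFunOnFinite.symm fun i : Fin n => c i.castSucc / k) d (by
        rw [Finsupp.degree_eq_sum]; simpa using h)
    refine hred c hc _ ⟨a, by rw [← had, Finsupp.degree_eq_sum], rfl⟩ fun j => ?_
    rw [m.degree_prod fun i _ => pow_ne_zero _ (hne i)]
    simp only [m.degree_pow, hdeg, Finsupp.finsetSum_apply, Finsupp.smul_apply, smul_eq_mul]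
    refine Fin.lastCases ?_ (fun i => ?_) j
    · rw [Finset.sum_eq_zero]
      · exact Nat.zero_le _
      · intro i _
        rw [Finsupp.single_eq_of_ne (Fin.castSucc_lt_last i).ne', mul_zero]
    · rw [Finset.sum_eq_single i]
      · rw [Finsupp.single_eq_same]
        exact (Nat.mul_le_mul_right k (ha i)).trans (Nat.div_mul_le_self _ _)
      · intro l _ hl
        rw [Finsupp.single_eq_of_ne fun h => hl (Fin.castSucc_injective n h).symm, mul_zero]
      · simp

lemma fatPointsIdeal_eq_pow (hk : 0 < k) (hξ : IsPrimitiveRoot ξ k) (d : ℕ) :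
    fatPointsIdeal (xiPoints n k ξ) d = pointsIdeal (xiPoints n k ξ) ^ d := by
  refine le_antisymm ?_ (pointsIdeal_pow_le_fatPointsIdeal _ d)
  -- Generation does not depend on the order, so one admissible order suffices; in `lex` the last
  -- variable is the smallest.
  rw [← (isGroebnerBasis_formMonomials hk hξ d MonomialOrder.lex fun i =>
    MonomialOrder.lex_lt_iff.2 (Finsupp.Lex.single_lt_iff.2 (Fin.castSucc_lt_last i))).1]
  exact Ideal.span_le.2 (formMonomials_subset hk hξ d)

end RootPoints

theorem mainTheorem6 (n d : ℕ) (hn : 1 ≤ n) (hd : 1 ≤ d) :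
    (fatPointsIdeal (pmPoints n) d = pointsIdeal (pmPoints n) ^ d ∧
      ∀ m : MonomialOrder (Fin (n + 1)),
        (∀ i : Fin n,
          m.toSyn (Finsupp.single (Fin.last n) 1) < m.toSyn (Finsupp.single i.castSucc 1)) →
        IsGroebnerBasis m (formMonomials n 2 d) (fatPointsIdeal (pmPoints n) d)) ∧
    (∀ (k : ℕ) (ξ : ℂ), 2 < k → IsPrimitiveRoot ξ k →
      fatPointsIdeal (xiPoints n k ξ) d = pointsIdeal (xiPoints n k ξ) ^ d ∧
      ∀ m : MonomialOrder (Fin (n + 1)),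
        (∀ i : Fin n,
          m.toSyn (Finsupp.single (Fin.last n) 1) < m.toSyn (Finsupp.single i.castSucc 1)) →
        IsGroebnerBasis m (formMonomials n k d) (fatPointsIdeal (xiPoints n k ξ) d)) := by
  have hneg : IsPrimitiveRoot (-1 : ℂ) 2 := IsPrimitiveRoot.neg_one 0 (by norm_num)
  rw [pmPoints_eq_xiPoints]
  exact ⟨⟨fatPointsIdeal_eq_pow two_pos hneg d, isGroebnerBasis_formMonomials two_pos hneg d⟩,
    fun k ξ hk hξ => ⟨fatPointsIdeal_eq_pow (by omega) hξ d,
      isGroebnerBasis_formMonomials (by omega) hξ d⟩⟩
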